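/- Let $G$ be a group, written multiplicatively, and let $\langle G\cup I\rangle = G\sqcup GI$ be its neutrosophic group: the monoid generated by $G$ and a new element $I$ subject to $I^2=I$ and $gI=Ig$ for all $g\in G$, so that its elements are the $g$ and the $gI$, $g\in G$, all distinct. Let $K$ be a field of characteristic $p>0$, and let $K[\langle G\cup I\rangle]$ be the monoid ring of $\langle G\cup I\rangle$ over $K$ (the neutrosophic group ring). Let $\Delta(\langle G\cup I\rangle)$ be the set of all $x\in\langle G\cup I\rangle$ whose centralizer $C(x)=\{y : xy=yx\}$ has finite index in $\langle G\cup I\rangle$, i.e. for which there are only finitely many distinct right cosets $C(x)n$, $n\in\langle G\cup I\rangle$. A subgroup of $\langle G\cup I\rangle$ is a submonoid that is a group; a neutrosophic subgroup is a submonoid of the form $\langle H\cup I\rangle$, generated by a subgroup $H$ and $I$; either is normal if $xP=Px$ for all $x\in\langle G\cup I\rangle$; its order is its number of elements. A ring is semiprime if it has no nonzero two-sided ideal $J$ with $J^2=0$. Then the following are equivalent: 1. $K[\langle G\cup I\rangle]$ is semiprime. 2. $\Delta(\langle G\cup I\rangle)$ has no element of order $p$. 3. $\langle G\cup I\rangle$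 has no finite normal subgroup of order divisible by $p$ and, if $p\neq 2$, no finite normal neutrosophic subgroup of order divisible by $p$. -/

import Mathlib

/-- The neutrosophic group `⟨G ∪ I⟩` of a (multiplicatively written) group `G`: the monoid generated
by `G` and one new element `I` that commutes with `G` and satisfies `I * I = I`. Its elements are the
`g` (with `indet = false`) and the `g I` (with `indet = true`), for `g` in `G`, all distinct. -/
@[ext]
structure NeutroGroup (G : Type*) where
  base : G
  indet : Bool

namespace NeutroGroup

variable {G : Type*} [Group G]

instance : Mul (NeutroGroup G) := ⟨fun x y => ⟨x.base * y.base, x.indet || y.indet⟩⟩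

instance : One (NeutroGroup G) := ⟨⟨1, false⟩⟩

theorem mul_def (x y : NeutroGroup G) :
    x * y = ⟨x.base * y.base, x.indet || y.indet⟩ := rfl

theorem one_def : (1 : NeutroGroup G) = ⟨1, false⟩ := rfl

instance : Monoid (NeutroGroup G) where
  mul_assoc x y z := by simp [mul_def, mul_assoc, Bool.or_assoc]
  one_mul x := by simp [mul_def, one_def]
  mul_one x := by simp [mul_def, one_def]

/-- The inclusion of `G` in `⟨G ∪ I⟩`. -/
def of : G →* NeutroGroup G where
  toFun g := ⟨g, false⟩
  map_one' := rfl
  map_mul' _ _ := rfl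

variable (G) in
/-- The indeterminate `I`. -/
def I : NeutroGroup G := ⟨1, true⟩

theorem I_mul_I : I G * I G = I G := by simp [I, mul_def]

theorem I_mul_comm (x : NeutroGroup G) : I G * x = x * I G := by simp [I, mul_def]

theorem of_injective : Function.Injective (of : G → NeutroGroup G) :=
  fun _ _ h => congrArg base h

theorem closure_range_of_union_I :
    Submonoid.closure (Set.range (of : G → NeutroGroup G) ∪ {I G}) = ⊤ := by
  rw [eq_top_iff]
  rintro ⟨g, b⟩ -
  have hg : of g ∈ Submonoid.closure (Set.range (of : G → NeutroGroup G) ∪ {I G}) :=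
    Submonoid.subset_closure (Or.inl ⟨g, rfl⟩)
  cases b with
  | false => exact hg
  | true =>
    have h := mul_mem hg (Submonoid.subset_closure
      (s := Set.range (of : G → NeutroGroup G) ∪ {I G}) (Or.inr rfl))
    simpa [of, I, mul_def] using h

/-- The right coset `H n = {h n | h ∈ H}`. -/
def rightCoset (H : Submonoid (NeutroGroup G)) (n : NeutroGroup G) : Set (NeutroGroup G) :=
  (fun h => h * n) '' (H : Set (NeutroGroup G))

variable (G) in
/-- The FC-part `Δ(⟨G ∪ I⟩)`: the elements whose centralizer has finite index in `⟨G ∪ I⟩`,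
that is, has only finitely many right cosets. -/
def Delta : Set (NeutroGroup G) :=
  {x | (Set.range (rightCoset (Submonoid.centralizer {x}))).Finite}

/-- `P` is a subgroup of `⟨G ∪ I⟩`: a submonoid that is a group. -/
def IsSubgroup (P : Submonoid (NeutroGroup G)) : Prop :=
  ∀ x ∈ P, ∃ y ∈ P, x * y = 1 ∧ y * x = 1

/-- `P` is a neutrosophic subgroup: `P = ⟨H ∪ I⟩`, generated by a subgroup `H` and `I`. -/
def IsNeutroSubgroup (P : Submonoid (NeutroGroup G)) : Prop :=
  ∃ H : Submonoid (NeutroGroup G), IsSubgroup H ∧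
    P = Submonoid.closure ((H : Set (NeutroGroup G)) ∪ {I G})

/-- `P` is normal in `⟨G ∪ I⟩`: `x P = P x` for every `x` in `⟨G ∪ I⟩`. Since `⟨G ∪ I⟩` is not a
group, the condition is stated without inverses. -/
def IsNormal (P : Submonoid (NeutroGroup G)) : Prop :=
  ∀ x : NeutroGroup G,
    (fun h => x * h) '' (P : Set (NeutroGroup G)) = (fun h => h * x) '' (P : Set (NeutroGroup G))

end NeutroGroup

/-- A ring is semiprime if it has no nonzero two-sided ideal with square zero. -/
def IsSemiprimeRing (R : Type*) [Ring R] : Prop :=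
  ∀ J : TwoSidedIdeal R, (∀ a ∈ J, ∀ b ∈ J, a * b = 0) → J = ⊥

/-!
The quotients of `K[⟨G ∪ I⟩]` by `I = 1` and by `I = 0` together embed it in `K[G] × K[G]`, and an
element of `⟨G ∪ I⟩` with an `I` is never a unit. All three conditions thereby become conditions on
`G`: the FC-part of `⟨G ∪ I⟩` lies over that of `G` (`NeutroGroup.mem_Delta_iff`), its finite normal
subgroups are those of `G`, and its finite normal neutrosophic subgroups are the `⟨H ∪ I⟩`, of order
`2 |H|`, with `H` finite and normal in `G` (`NeutroGroup.forall_isNormal_not_dvd_card_iff`). What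
remains is Passman's theorem on semiprime group algebras in characteristic `p`.

* A finite normal subgroup of order divisible by `p` gives a central element of square zero, the sum
  of its elements (`NeutroGroup.not_dvd_card_of_isSemiprimeRing`).
* An element of order `p` with finitely many conjugates has a finite normal closure, by Dietzmann's
  lemma (`finite_normalClosure_singleton`); conversely Cauchy's theorem finds such an element in any
  finite normal subgroup of order divisible by `p`.
* If `α K[G] α = 0`, then the FC-part of `α` squares to zero. This rests on B. H. Neumann's lemma on
  coverings by cosets (`MonoidAlgebra.fcPart_mul_eq_zero`). The `p`-th power map is additive modulo
  commutators (`map_sum_pow_char`), so when no element of the FC-center has order `p`, an element of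
  square zero supported there has coefficient `0` at the identity. Translating `α` by group elements
  kills all of its coefficients (`MonoidAlgebra.eq_zero_of_forall_mul_mul_eq_zero`).
-/

/-! ### Traces of `p`-th powers -/

/-- If a map `σ` with `σ ^ p = id` leaves a weight invariant, then modulo `p` only its fixed
points contribute to the total weight: on each level set of the weight, the number of points is
congruent to the number of fixed points. -/
theorem sum_eq_sum_filter_fixed {α R : Type*} [Fintype α] [DecidableEq α] [CommRing R] (p : ℕ)
    [Fact p.Prime] [CharP R p] (σ : α → α) (hσ : σ^[p] = id) (w : α → R)
    (hw : ∀ a, w (σ a) = w a) :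
    ∑ a, w a = ∑ a with σ a = a, w a := by
  classical
  rw [← Finset.sum_fiberwise_of_maps_to (s := Finset.univ) (t := Finset.univ.image w) (g := w)
      (fun a _ => Finset.mem_image_of_mem w (Finset.mem_univ a)) w,
    ← Finset.sum_fiberwise_of_maps_to (s := Finset.univ.filter fun a => σ a = a)
      (t := Finset.univ.image w) (g := w)
      (fun a _ => Finset.mem_image_of_mem w (Finset.mem_univ a)) w]
  refine Finset.sum_congr rfl fun c _ => ?_
  have hconst : ∀ s : Finset α,
      ∑ a ∈ s with w a = c, w a = ((s.filter fun a => w a = c).card : R) * c := by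
    intro s
    rw [Finset.sum_congr rfl (g := fun _ => c) (fun a ha => (Finset.mem_filter.1 ha).2)]
    simp
  rw [hconst, hconst]
  congr 1
  rw [CharP.natCast_eq_natCast R p]
  let τ : Function.End {a // w a = c} := fun a => ⟨σ a, (hw a).trans a.2⟩
  have hτ_iter : ∀ (n : ℕ) (a : {a // w a = c}), ((τ^[n] a : {a // w a = c}) : α) = σ^[n] a := by
    intro n
    induction n with
    | zero => intro a; rfl
    | succ n ih => intro a; rw [Function.iterate_succ_apply, Function.iterate_succ_apply, ih]
  have hτ : τ ^ p ^ 1 = 1 := by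
    rw [pow_one]
    funext a
    apply Subtype.ext
    have h1 : (τ ^ p) a = τ^[p] a := by
      have := Function.End.smul_def (τ ^ p) a
      rw [← this, ← smul_iterate_apply]; rfl
    rw [h1, hτ_iter, hσ]
    rfl
  have key := Equiv.Perm.card_fixedPoints_modEq hτ
  have e1 : Fintype.card {a // w a = c} = (Finset.univ.filter fun a => w a = c).card :=
    Fintype.card_subtype _
  have e2 : Fintype.card (Function.fixedPoints τ) =
      ((Finset.univ.filter fun a => σ a = a).filter fun a => w a = c).card := by
    rw [Finset.filter_filter, ← Fintype.card_subtype]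
    refine Fintype.card_congr
      { toFun := fun a => ⟨a.1.1, congrArg Subtype.val a.2, a.1.2⟩
        invFun := fun a => ⟨⟨a.1, a.2.2⟩, Subtype.ext a.2.1⟩
        left_inv := fun _ => rfl
        right_inv := fun _ => rfl }
  rwa [e1, e2] at key

theorem sum_pow_eq_sum_prod_ofFn {A ι : Type*} [Semiring A] [Fintype ι] (x : ι → A) (n : ℕ) :
    (∑ i, x i) ^ n = ∑ f : Fin n → ι, (List.ofFn fun k => x (f k)).prod := by
  induction n with
  | zero => simp
  | succ n ih =>
    rw [pow_succ', ih, Finset.sum_mul_sum, ← Fintype.sum_prod_type',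
      ← (Fin.consEquiv fun _ : Fin (n + 1) => ι).sum_comp]
    refine Finset.sum_congr rfl fun q _ => ?_
    simp [List.ofFn_succ, Fin.consEquiv]

open scoped Fin.NatCast Fin.CommRing in
/-- In characteristic `p`, the `p`-th power map is additive modulo commutators. Expanding the power
gives a sum over words of length `p`; a trace does not change when a word is rotated, and the words
fixed by the rotation are the constant ones. -/
theorem map_sum_pow_char {A R ι : Type*} [Ring A] [CommRing R] (p : ℕ) [hp : Fact p.Prime]
    [CharP R p] [Fintype ι] (τ : A →+ R) (hτ : ∀ a b, τ (a * b) = τ (b * a)) (x : ι → A) :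
    τ ((∑ i, x i) ^ p) = ∑ i, τ (x i ^ p) := by
  classical
  obtain ⟨n, rfl⟩ : ∃ n, p = n + 1 := ⟨p - 1, (Nat.succ_pred_prime hp.out).symm⟩
  rw [sum_pow_eq_sum_prod_ofFn, map_sum]
  let σ : (Fin (n + 1) → ι) → (Fin (n + 1) → ι) := fun f k => f (k + 1)
  have hiter : ∀ (m : ℕ) (f : Fin (n + 1) → ι) (k), σ^[m] f k = f (k + (m : Fin (n + 1))) := by
    intro m
    induction m with
    | zero => simp
    | succ m ih =>
      intro f k
      rw [Function.iterate_succ_apply, ih]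
      simp only [σ, Nat.cast_succ, add_assoc]
  rw [sum_eq_sum_filter_fixed (n + 1) σ]
  · have hfix : ∀ f : Fin (n + 1) → ι, σ f = f → f = fun _ => f 0 := by
      intro f hf
      funext k
      have h1 := hiter k.val f 0
      rw [Function.iterate_fixed hf] at h1
      simpa using h1.symm
    symm
    refine Finset.sum_bij' (fun i _ => fun _ => i) (fun f _ => f 0) ?_ ?_ ?_ ?_ ?_
    · intro i _
      simp [σ]
    · simp
    · simp
    · intro f hf
      exact (hfix f (Finset.mem_filter.1 hf).2).symm
    · intro i _
      rw [List.ofFn_const, List.prod_replicate]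
  · funext f k
    rw [hiter]
    simp
  · intro f
    have h1 : (List.ofFn fun k => x (σ f k)).prod =
        (List.ofFn fun k : Fin n => x (f k.succ)).prod * x (f 0) := by
      rw [List.ofFn_succ', List.concat_eq_append, List.prod_append]
      simp [σ, Fin.coeSucc_eq_succ]
    rw [h1, hτ, List.ofFn_succ, List.prod_cons]

/-! ### The coefficient of the identity in a group algebra -/

namespace MonoidAlgebra

variable {K G : Type*} [Field K] [Group G]

theorem coeff_one_mul_comm (α β : MonoidAlgebra K G) :
    (α * β).coeff 1 = (β * α).coeff 1 := by
  classical
  induction α using MonoidAlgebra.induction_linear with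
  | zero => simp
  | add a b ha hb => simp [add_mul, mul_add, ha, hb]
  | single g a =>
    rw [coeff_single_mul_apply, coeff_mul_single_apply, mul_one, one_mul, mul_comm]

/-- If no element of the support of `α` has order `p`, then the coefficient of `1` in `α ^ p` is the
`p`-th power of that in `α`, so it vanishes when `α` squares to zero. -/
theorem coeff_one_eq_zero_of_mul_self_eq_zero (p : ℕ) [hp : Fact p.Prime] [CharP K p]
    (α : MonoidAlgebra K G) (hα : α * α = 0) (hord : ∀ g ∈ α.coeff.support, orderOf g ≠ p) :
    α.coeff 1 = 0 := by
  classical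
  let τ : MonoidAlgebra K G →+ K :=
    { toFun := fun x => x.coeff 1, map_zero' := rfl, map_add' := fun _ _ => rfl }
  have hsum : ∑ g : α.coeff.support, single (g : G) (α.coeff g) = α := by
    rw [Finset.sum_coe_sort α.coeff.support fun g => single g (α.coeff g)]
    exact sum_coeff_single α
  have hpow : α ^ p = 0 := by
    obtain ⟨n, hn⟩ := Nat.exists_eq_add_of_le hp.out.two_le
    rw [hn, pow_add, pow_two, hα, zero_mul]
  have key := map_sum_pow_char p τ coeff_one_mul_comm
    fun g : α.coeff.support => single (g : G) (α.coeff g)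
  rw [hsum, hpow, map_zero] at key
  by_contra h1
  have hmem : (1 : G) ∈ α.coeff.support := Finsupp.mem_support_iff.2 h1
  rw [Finset.sum_eq_single (⟨1, hmem⟩ : α.coeff.support)] at key
  · apply h1
    have : (α.coeff 1) ^ p = 0 := by
      rw [single_pow, one_pow] at key
      exact (key.trans Finsupp.single_eq_same).symm
    exact eq_zero_of_pow_eq_zero this
  · rintro ⟨g, hg⟩ - hne
    have hgp : g ^ p ≠ 1 := fun h =>
      hord g hg (orderOf_eq_prime h fun h' => hne (Subtype.ext h'))
    rw [single_pow]
    exact Finsupp.single_eq_of_ne hgp.symm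
  · simp

end MonoidAlgebra

/-! ### Elements with finitely many conjugates -/

/-- The FC-center of a group: the elements whose centralizer has finite index. -/
def fcCenter (G : Type*) [Group G] : Subgroup G where
  carrier := {x | (Subgroup.centralizer {x}).FiniteIndex}
  one_mem' := by
    have : Subgroup.centralizer {(1 : G)} = ⊤ := by
      ext y; simp [Subgroup.mem_centralizer_singleton_iff]
    rw [Set.mem_ofPred_eq, this]
    infer_instance
  mul_mem' {a b} ha hb := by
    have := ha.out
    have := hb.out
    refine Subgroup.finiteIndex_of_le (H := Subgroup.centralizer {a} ⊓ Subgroup.centralizer {b}) ?_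
    intro y hy
    have h1 := Subgroup.mem_centralizer_singleton_iff.1 hy.1
    have h2 := Subgroup.mem_centralizer_singleton_iff.1 hy.2
    rw [Subgroup.mem_centralizer_singleton_iff]
    exact (Commute.mul_right h1 h2 : Commute y (a * b))
  inv_mem' {a} ha := by
    have := ha.out
    refine Subgroup.finiteIndex_of_le (H := Subgroup.centralizer {a}) ?_
    intro y hy
    rw [Subgroup.mem_centralizer_singleton_iff] at hy ⊢
    exact (Commute.inv_right hy : Commute y a⁻¹)

section FC

variable {G : Type*} [Group G]

theorem mem_fcCenter {x : G} : x ∈ fcCenter G ↔ (Subgroup.centralizer {x}).FiniteIndex := Iff.rfl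

theorem mem_fcCenter_iff_finite_conjugatesOf {x : G} :
    x ∈ fcCenter G ↔ (conjugatesOf x).Finite := by
  have e : Set.range (fun g : G => g * x * g⁻¹) = conjugatesOf x := by
    ext y
    simp [conjugatesOf, isConj_iff]
  have hker : ∀ a b : G, QuotientGroup.leftRel (Subgroup.centralizer {x}) a b ↔
      a * x * a⁻¹ = b * x * b⁻¹ := by
    intro a b
    rw [QuotientGroup.leftRel_apply, Subgroup.mem_centralizer_singleton_iff]
    constructor
    · intro h
      calc a * x * a⁻¹ = a * (x * (a⁻¹ * b)) * b⁻¹ := by group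
        _ = a * ((a⁻¹ * b) * x) * b⁻¹ := by rw [h]
        _ = b * x * b⁻¹ := by group
    · intro h
      calc a⁻¹ * b * x = a⁻¹ * (b * x * b⁻¹) * b := by group
        _ = a⁻¹ * (a * x * a⁻¹) * b := by rw [h]
        _ = x * (a⁻¹ * b) := by group
  let f : G ⧸ Subgroup.centralizer {x} → G :=
    Quotient.lift (fun g : G => g * x * g⁻¹) fun a b h => (hker a b).1 h
  have hf : Function.Injective f := by
    intro a b
    refine Quotient.inductionOn₂ a b fun a b h => Quotient.sound ((hker a b).2 h)
  have hrange : Set.range f = conjugatesOf x := by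
    rw [← e]
    ext y
    constructor
    · rintro ⟨q, rfl⟩
      exact Quotient.inductionOn q fun a => ⟨a, rfl⟩
    · rintro ⟨a, rfl⟩
      exact ⟨(a : G ⧸ Subgroup.centralizer {x}), rfl⟩
  rw [mem_fcCenter, Subgroup.finiteIndex_iff_finite_quotient, ← hrange]
  exact ⟨fun _ => Set.finite_range f, fun h => (Set.finite_range_iff hf).1 h⟩

instance : (fcCenter G).Normal where
  conj_mem x hx g := by
    rw [mem_fcCenter_iff_finite_conjugatesOf] at hx ⊢
    rwa [← (isConj_iff.2 ⟨g, rfl⟩ : IsConj x (g * x * g⁻¹)).conjugatesOf_eq]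

open scoped commutatorElement in
/-- A group generated by finitely many elements, each of finite order and with centralizer of finite
index, is finite: its center has finite index, so its commutator subgroup is finite by Schur's
theorem, and its abelianization is finitely generated and torsion. -/
theorem finite_of_closure_eq_top (S : Set G) (hS : S.Finite) (hgen : Subgroup.closure S = ⊤)
    (hfc : ∀ s ∈ S, s ∈ fcCenter G) (hord : ∀ s ∈ S, IsOfFinOrder s) : Finite G := by
  have := hS.to_subtype
  have hcenter : (Subgroup.center G).FiniteIndex := by
    have : (⨅ s : S, Subgroup.centralizer {(s : G)}).FiniteIndex :=
      Subgroup.finiteIndex_iInf fun s => hfc s s.2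
    refine Subgroup.finiteIndex_of_le (H := ⨅ s : S, Subgroup.centralizer {(s : G)}) ?_
    intro y hy
    have hle : Subgroup.closure S ≤ Subgroup.centralizer {y} := by
      rw [Subgroup.closure_le]
      intro s hs
      have := Subgroup.mem_iInf.1 hy ⟨s, hs⟩
      rw [Subgroup.mem_centralizer_singleton_iff] at this
      exact Subgroup.mem_centralizer_singleton_iff.2 this.symm
    rw [hgen] at hle
    exact Subgroup.mem_center_iff.2 fun g =>
      Subgroup.mem_centralizer_singleton_iff.1 (hle (Subgroup.mem_top g))
  have hcomm : Finite (commutatorSet G) := by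
    have hred : ∀ a b c : G, ⁅a * c, b⁆ = ⁅a, b⁆ ∨ c ∉ Subgroup.center G := by
      intro a b c
      by_cases hc : c ∈ Subgroup.center G
      · left
        rw [Subgroup.mem_center_iff] at hc
        simp only [commutatorElement_def, mul_inv_rev]
        calc a * c * b * (c⁻¹ * a⁻¹) * b⁻¹ = a * (c * b) * c⁻¹ * a⁻¹ * b⁻¹ := by group
          _ = a * (b * c) * c⁻¹ * a⁻¹ * b⁻¹ := by rw [hc b]
          _ = a * b * a⁻¹ * b⁻¹ := by group
      · exact Or.inr hc
    have hout : ∀ a b : G, ⁅(a : G ⧸ Subgroup.center G).out, b⁆ = ⁅a, b⁆ := by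
      intro a b
      have h := QuotientGroup.mk_out_eq_mul (Subgroup.center G) a
      obtain ⟨z, hz⟩ := h
      rw [hz]
      exact (hred a b z).resolve_right (not_not.2 z.2)
    refine (Set.Finite.subset (Set.finite_range
      fun q : (G ⧸ Subgroup.center G) × (G ⧸ Subgroup.center G) => ⁅q.1.out, q.2.out⁆)
      ?_).to_subtype
    rintro _ ⟨a, b, rfl⟩
    refine ⟨((a : G ⧸ Subgroup.center G), (b : G ⧸ Subgroup.center G)), ?_⟩
    change ⁅(a : G ⧸ Subgroup.center G).out, (b : G ⧸ Subgroup.center G).out⁆ = ⁅a, b⁆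
    rw [hout, ← commutatorElement_inv, hout, commutatorElement_inv]
  have hfin : Finite (commutator G) := inferInstance
  have : Group.FG G := Group.fg_iff.2 ⟨S, hgen, hS⟩
  have hfg : Group.FG (Abelianization G) :=
    Group.fg_of_surjective (f := Abelianization.of) QuotientGroup.mk_surjective
  have htors : ∀ q : Abelianization G, IsOfFinOrder q := by
    intro q
    obtain ⟨g, rfl⟩ := QuotientGroup.mk_surjective q
    have hle : Subgroup.closure S ≤
        (CommGroup.torsion (Abelianization G)).comap Abelianization.of := by
      rw [Subgroup.closure_le]
      intro s hs
      exact MonoidHom.isOfFinOrder Abelianization.of (hord s hs)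
    rw [hgen] at hle
    exact hle (Subgroup.mem_top g)
  have hab : Finite (G ⧸ commutator G) :=
    CommGroup.finite_of_fg_isMulTorsion (Abelianization G) htors
  exact Finite.of_subgroup_quotient (commutator G)

/-- A case of Dietzmann's lemma: an element of finite order with finitely many conjugates has a
finite normal closure. -/
theorem finite_normalClosure_singleton {x : G} (hx : x ∈ fcCenter G) (hord : IsOfFinOrder x) :
    Finite (Subgroup.normalClosure {x}) := by
  set H := Subgroup.normalClosure {x} with hH
  have hconj : ∀ y ∈ conjugatesOf x, y ∈ H := fun y hy =>
    Subgroup.conjugatesOfSet_subset_normalClosure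
      (Group.mem_conjugatesOfSet_iff.2 ⟨x, rfl, hy⟩)
  have hcl : Subgroup.closure (conjugatesOf x) = H := by
    rw [hH, Subgroup.normalClosure, Group.conjugatesOfSet, Set.biUnion_singleton]
  refine finite_of_closure_eq_top (Subtype.val ⁻¹' conjugatesOf x : Set H)
    (((mem_fcCenter_iff_finite_conjugatesOf).1 hx).preimage Subtype.val_injective.injOn) ?_ ?_ ?_
  · apply Subgroup.map_injective H.subtype_injective
    rw [MonoidHom.map_closure, ← MonoidHom.range_eq_map, Subgroup.range_subtype,
      Subgroup.coe_subtype, ← hcl]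
    congr 1
    rw [hcl]
    exact (Subtype.image_preimage_coe _ _).trans (Set.inter_eq_self_of_subset_right hconj)
  · rintro ⟨y, hyH⟩ hy
    obtain ⟨g, rfl⟩ := isConj_iff.1 hy
    have := (inferInstance : (fcCenter G).Normal).conj_mem x hx g
    have := mem_fcCenter.1 this
    refine Subgroup.finiteIndex_of_le
      (H := (Subgroup.centralizer {g * x * g⁻¹}).subgroupOf H) ?_
    intro z hz
    rw [Subgroup.mem_subgroupOf, Subgroup.mem_centralizer_singleton_iff] at hz
    exact Subgroup.mem_centralizer_singleton_iff.2 (Subtype.ext hz)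
  · rintro ⟨y, hyH⟩ hy
    obtain ⟨g, rfl⟩ := isConj_iff.1 hy
    rw [← Submonoid.isOfFinOrder_coe]
    exact (MulAut.conj g).toMonoidHom.isOfFinOrder hord

/-- One direction is Cauchy's theorem, the other Dietzmann's lemma. -/
theorem forall_mem_fcCenter_orderOf_ne_iff {p : ℕ} (hp : p.Prime) :
    (∀ g ∈ fcCenter G, orderOf g ≠ p) ↔
      ∀ H : Subgroup G, H.Normal → Finite H → ¬ p ∣ Nat.card H := by
  have := Fact.mk hp
  constructor
  · intro h H hn hfin hdvd
    obtain ⟨g, hg⟩ := exists_prime_orderOf_dvd_card' p hdvd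
    refine h g ?_ (by rw [Subgroup.orderOf_coe, hg])
    rw [mem_fcCenter_iff_finite_conjugatesOf]
    refine (Set.toFinite (H : Set G)).subset fun y hy => ?_
    obtain ⟨x, rfl⟩ := isConj_iff.1 hy
    exact hn.conj_mem g g.2 x
  · intro h g hg hord
    have hfin := finite_normalClosure_singleton hg
      (orderOf_pos_iff.1 (by rw [hord]; exact hp.pos))
    refine h (Subgroup.normalClosure {g}) inferInstance hfin ?_
    rw [← hord]
    exact Subgroup.orderOf_dvd_natCard _ (Subgroup.subset_normalClosure rfl)

end FC

/-! ### The projection of a group algebra to its FC-part -/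

open scoped Pointwise in
/-- A subgroup of finite index is not covered by finitely many cosets of subgroups of infinite index
(B. H. Neumann). -/
theorem exists_mem_forall_notMem_leftCoset {G ι : Type*} [Group G] (W : Subgroup G)
    [W.FiniteIndex] (s : Finset ι) (g : ι → G) (H : ι → Subgroup G)
    (hH : ∀ i ∈ s, ¬ (H i).FiniteIndex) : ∃ w ∈ W, ∀ i ∈ s, w ∉ g i • (H i : Set G) := by
  classical
  by_contra! hcov
  have := Fintype.ofFinite (G ⧸ W)
  obtain ⟨k, hk, hfin⟩ := Subgroup.exists_finiteIndex_of_leftCoset_cover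
    (s := (Finset.univ : Finset (G ⧸ W)) ×ˢ s) (g := fun k => k.1.out * g k.2)
    (H := fun k => H k.2) (by
      refine Set.eq_univ_of_forall fun y => ?_
      obtain ⟨w, hw⟩ := QuotientGroup.mk_out_eq_mul W y
      obtain ⟨i, hi, hwi⟩ := hcov (w : G)⁻¹ (W.inv_mem w.2)
      refine Set.mem_iUnion₂.2 ⟨((y : G ⧸ W), i), by simp [hi], ?_⟩
      rw [Set.mem_smul_set_iff_inv_smul_mem] at hwi ⊢
      have : y = (y : G ⧸ W).out * (w : G)⁻¹ := by rw [hw]; group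
      have h2 : ((y : G ⧸ W).out * g i)⁻¹ • y = (g i)⁻¹ • (w : G)⁻¹ := by
        rw [smul_eq_mul, smul_eq_mul, mul_inv_rev, mul_assoc]
        congr 1
        exact inv_mul_eq_iff_eq_mul.2 this
      exact h2 ▸ hwi)
  exact hH k.2 (Finset.mem_product.1 hk).2 hfin

namespace MonoidAlgebra

variable {K G : Type*} [Field K] [Group G]

open Classical in
/-- The part of `α` supported on the FC-center. -/
noncomputable def fcPart (α : MonoidAlgebra K G) : MonoidAlgebra K G :=
  ofCoeff (α.coeff.filter (· ∈ fcCenter G))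

open Classical in
theorem coeff_fcPart_of_mem (α : MonoidAlgebra K G) {g : G} (hg : g ∈ fcCenter G) :
    (fcPart α).coeff g = α.coeff g :=
  Finsupp.filter_apply_pos _ _ hg

open Classical in
theorem coeff_fcPart_of_notMem (α : MonoidAlgebra K G) {g : G} (hg : g ∉ fcCenter G) :
    (fcPart α).coeff g = 0 :=
  Finsupp.filter_apply_neg _ _ hg

theorem mem_fcCenter_of_mem_support_fcPart {α : MonoidAlgebra K G} {g : G}
    (hg : g ∈ (fcPart α).coeff.support) : g ∈ fcCenter G := by
  by_contra h
  exact Finsupp.mem_support_iff.1 hg (coeff_fcPart_of_notMem α h)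

theorem fcPart_mul_fcPart (α β : MonoidAlgebra K G) :
    fcPart (fcPart α * β) = fcPart α * fcPart β := by
  ext u
  by_cases hu : u ∈ fcCenter G
  · rw [coeff_fcPart_of_mem _ hu, coeff_mul_apply_left, coeff_mul_apply_left]
    refine Finsupp.sum_congr fun g hg => ?_
    rw [coeff_fcPart_of_mem β
      (mul_mem (inv_mem (mem_fcCenter_of_mem_support_fcPart hg)) hu)]
  · rw [coeff_fcPart_of_notMem _ hu, coeff_mul_apply_left, Finsupp.sum]
    refine (Finset.sum_eq_zero fun g hg => ?_).symm
    rw [coeff_fcPart_of_notMem β, mul_zero]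
    intro h
    have := mul_mem (mem_fcCenter_of_mem_support_fcPart hg) h
    rw [mul_inv_cancel_left] at this
    exact hu this

open scoped Pointwise in
/-- If `α x β = 0` for every group element `x`, then the FC-part of `α` already annihilates `β`.
Let `x` range over the finite-index subgroup centralizing the FC-part `α₀` of `α`, and write
`0 = x⁻¹ α x β = α₀ β + x⁻¹ (α - α₀) x β`. A fixed `v` lies in the support of the last term only if
`x⁻¹ g x = v h⁻¹` for one of finitely many pairs `(g, h)` with `g` outside the FC-center, which
confines `x` to finitely many cosets of centralizers of infinite index. -/
theorem fcPart_mul_eq_zero {α β : MonoidAlgebra K G}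
    (h : ∀ x : G, α * single x 1 * β = 0) : fcPart α * β = 0 := by
  classical
  ext v
  set γ := α - fcPart α with hγ
  have hγ_supp : ∀ g ∈ γ.coeff.support, g ∉ fcCenter G := by
    intro g hg hmem
    refine Finsupp.mem_support_iff.1 hg ?_
    change α.coeff g - (fcPart α).coeff g = 0
    rw [coeff_fcPart_of_mem α hmem, sub_self]
  let W : Subgroup G := ⨅ g : (fcPart α).coeff.support, Subgroup.centralizer {(g : G)}
  have hW : W.FiniteIndex := Subgroup.finiteIndex_iInf fun g =>
    mem_fcCenter.1 (mem_fcCenter_of_mem_support_fcPart g.2)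
  let s := (γ.coeff.support ×ˢ β.coeff.support).filter
    fun k => ∃ x : G, x⁻¹ * k.1 * x = v * k.2⁻¹
  -- A chosen solution `x₀ k` of `x⁻¹ g x = v h⁻¹`: all solutions lie in the coset of the centralizer
  -- of `v h⁻¹` that contains it.
  let x₀ : G × G → G := fun k =>
    if hk : ∃ x : G, x⁻¹ * k.1 * x = v * k.2⁻¹ then hk.choose else 1
  have hx₀ : ∀ k ∈ s, (x₀ k)⁻¹ * k.1 * x₀ k = v * k.2⁻¹ := by
    intro k hk
    have hk' := (Finset.mem_filter.1 hk).2
    simp only [x₀, dif_pos hk']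
    exact hk'.choose_spec
  obtain ⟨x, hxW, hx⟩ := exists_mem_forall_notMem_leftCoset W s x₀
    (fun k => Subgroup.centralizer {v * k.2⁻¹}) (by
      intro k hk hfin
      refine hγ_supp k.1 (Finset.mem_product.1 (Finset.mem_filter.1 hk).1).1 ?_
      have h1 : v * k.2⁻¹ ∈ fcCenter G := mem_fcCenter.2 hfin
      rw [← hx₀ k hk] at h1
      have h2 := (inferInstance : (fcCenter G).Normal).conj_mem _ h1 (x₀ k)
      have h3 : x₀ k * ((x₀ k)⁻¹ * k.1 * x₀ k) * (x₀ k)⁻¹ = k.1 := by group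
      rwa [h3] at h2)
  have hcomm : single x (1 : K) * fcPart α = fcPart α * single x 1 := by
    have hsum : fcPart α = ∑ g ∈ (fcPart α).coeff.support, single g ((fcPart α).coeff g) :=
      (sum_coeff_single (fcPart α)).symm
    rw [hsum, Finset.mul_sum, Finset.sum_mul]
    refine Finset.sum_congr rfl fun g hg => ?_
    have h1 := Subgroup.mem_iInf.1 hxW ⟨g, hg⟩
    rw [Subgroup.mem_centralizer_singleton_iff] at h1
    rw [single_mul_single, single_mul_single, h1, one_mul, mul_one]
  have hinv : single x⁻¹ (1 : K) * single x 1 = 1 := by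
    rw [single_mul_single, inv_mul_cancel, one_mul, one_def]
  have hsplit : fcPart α * β + single x⁻¹ 1 * γ * single x 1 * β = 0 := by
    have h1 : single x⁻¹ 1 * fcPart α * single x 1 = fcPart α := by
      rw [mul_assoc, ← hcomm, ← mul_assoc, hinv, one_mul]
    calc fcPart α * β + single x⁻¹ 1 * γ * single x 1 * β
        = single x⁻¹ 1 * fcPart α * single x 1 * β + single x⁻¹ 1 * γ * single x 1 * β := by
          rw [h1]
      _ = single x⁻¹ 1 * ((fcPart α + γ) * single x 1 * β) := by noncomm_ring
      _ = 0 := by rw [hγ, add_sub_cancel, h, mul_zero]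
  have hv : (single x⁻¹ 1 * γ * single x 1 * β).coeff v = 0 := by
    by_contra hne
    obtain ⟨g', hg', b, hb, hgb⟩ := Finset.mem_mul.1
      (support_coeff_mul_subset _ _ (Finsupp.mem_support_iff.2 hne))
    rw [Finsupp.mem_support_iff, coeff_mul_single_apply, coeff_single_mul_apply, inv_inv,
      mul_one, one_mul] at hg'
    have hconj : x⁻¹ * (x * (g' * x⁻¹)) * x = v * b⁻¹ := by
      rw [← hgb]; group
    have hk : (x * (g' * x⁻¹), b) ∈ s := by
      exact Finset.mem_filter.2
        ⟨Finset.mem_product.2 ⟨Finsupp.mem_support_iff.2 hg', hb⟩, x, hconj⟩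
    refine hx _ hk ?_
    have h0 := hx₀ _ hk
    rw [Set.mem_smul_set_iff_inv_smul_mem, SetLike.mem_coe,
      Subgroup.mem_centralizer_singleton_iff, smul_eq_mul]
    generalize x₀ (x * (g' * x⁻¹), b) = y at h0 ⊢
    dsimp only at h0 ⊢
    generalize x * (g' * x⁻¹) = g at h0 hconj
    calc y⁻¹ * x * (v * b⁻¹) = y⁻¹ * x * (x⁻¹ * g * x) := by rw [hconj]
      _ = (y⁻¹ * g * y) * (y⁻¹ * x) := by group
      _ = v * b⁻¹ * (y⁻¹ * x) := by rw [h0]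
  have := congrArg (fun z => z.coeff v) hsplit
  simpa [hv] using this

/-- Passman's theorem: in characteristic `p`, if no element of the FC-center has order `p`, then
`α K[G] α = 0` forces `α = 0`. The coefficient of `g` in `α` is that of `1` in the FC-part of
`α g⁻¹`, and this FC-part squares to zero. -/
theorem eq_zero_of_forall_mul_mul_eq_zero (p : ℕ) [Fact p.Prime] [CharP K p]
    (hp : ∀ x ∈ fcCenter G, orderOf x ≠ p) (α : MonoidAlgebra K G)
    (hα : ∀ x, α * x * α = 0) : α = 0 := by
  ext g
  set β := α * single g⁻¹ 1 with hβ
  have h1 : ∀ x : G, β * single x 1 * β = 0 := by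
    intro x
    calc β * single x 1 * β = α * (single g⁻¹ 1 * single x 1) * α * single g⁻¹ 1 := by
          rw [hβ]; noncomm_ring
      _ = 0 := by rw [hα, zero_mul]
  have h2 : fcPart β * fcPart β = 0 := by
    rw [← fcPart_mul_fcPart, fcPart_mul_eq_zero h1]
    ext u
    by_cases hu : u ∈ fcCenter G
    · exact coeff_fcPart_of_mem _ hu
    · exact coeff_fcPart_of_notMem _ hu
  have h3 := coeff_one_eq_zero_of_mul_self_eq_zero p (fcPart β) h2
    fun x hx => hp x (mem_fcCenter_of_mem_support_fcPart hx)
  rw [coeff_fcPart_of_mem β (one_mem _), hβ] at h3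
  simpa using h3

end MonoidAlgebra

/-! ### The neutrosophic group and its subgroups -/

namespace NeutroGroup

variable {G : Type*} [Group G]

/-- The projection of `⟨G ∪ I⟩` onto `G` that sends `I` to `1`. -/
def baseHom : NeutroGroup G →* G where
  toFun := base
  map_one' := rfl
  map_mul' _ _ := rfl

theorem mem_centralizer_singleton_iff {x y : NeutroGroup G} :
    y ∈ Submonoid.centralizer {x} ↔ x.base * y.base = y.base * x.base := by
  simp [Submonoid.mem_centralizer_iff, mul_def, Bool.or_comm]

/-- The coset `C(x) n` is determined by whether `n` involves `I` and by the conjugate of the base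
of `x` by that of `n`. -/
theorem rightCoset_centralizer (x n : NeutroGroup G) :
    rightCoset (Submonoid.centralizer {x}) n =
      {y | y.base⁻¹ * x.base * y.base = n.base⁻¹ * x.base * n.base ∧
        (n.indet = true → y.indet = true)} := by
  ext y
  constructor
  · rintro ⟨c, hc, rfl⟩
    have hc' := mem_centralizer_singleton_iff.1 hc
    refine ⟨?_, fun h => by simp [mul_def, h]⟩
    change (c.base * n.base)⁻¹ * x.base * (c.base * n.base) = _
    calc (c.base * n.base)⁻¹ * x.base * (c.base * n.base)
        = n.base⁻¹ * c.base⁻¹ * (x.base * c.base) * n.base := by group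
      _ = n.base⁻¹ * c.base⁻¹ * (c.base * x.base) * n.base := by rw [hc']
      _ = n.base⁻¹ * x.base * n.base := by group
  · rintro ⟨h1, h2⟩
    refine ⟨⟨y.base * n.base⁻¹, y.indet⟩, mem_centralizer_singleton_iff.2 ?_, ?_⟩
    · change x.base * (y.base * n.base⁻¹) = y.base * n.base⁻¹ * x.base
      calc x.base * (y.base * n.base⁻¹)
          = y.base * (y.base⁻¹ * x.base * y.base) * n.base⁻¹ := by group
        _ = y.base * (n.base⁻¹ * x.base * n.base) * n.base⁻¹ := by rw [h1]
        _ = y.base * n.base⁻¹ * x.base := by group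
    · cases hn : n.indet <;> simp_all [mul_def, NeutroGroup.ext_iff]

theorem mem_Delta_iff {x : NeutroGroup G} : x ∈ Delta G ↔ x.base ∈ fcCenter G := by
  rw [mem_fcCenter_iff_finite_conjugatesOf]
  have hmem : ∀ m : G, m⁻¹ * x.base * m ∈ conjugatesOf x.base := fun m =>
    isConj_iff.2 ⟨m⁻¹, by rw [inv_inv]⟩
  constructor
  · intro h
    refine Set.Finite.of_finite_image (f := fun c : G => ({c} : Set G)) ?_
      Set.singleton_injective.injOn
    refine (h.image fun S => (fun y : NeutroGroup G => y.base⁻¹ * x.base * y.base) '' S).subset ?_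
    rintro _ ⟨c, hc, rfl⟩
    obtain ⟨m, rfl⟩ := isConj_iff.1 hc
    refine ⟨_, ⟨of m⁻¹, rfl⟩, ?_⟩
    dsimp only
    rw [rightCoset_centralizer]
    ext d
    constructor
    · rintro ⟨y, ⟨hy, -⟩, rfl⟩
      simpa [of] using hy
    · rintro rfl
      exact ⟨of m⁻¹, ⟨rfl, id⟩, by simp [of]⟩
  · intro h
    refine ((h.prod (Set.finite_univ (α := Bool))).image fun q =>
      {y : NeutroGroup G | y.base⁻¹ * x.base * y.base = q.1 ∧
        (q.2 = true → y.indet = true)}).subset ?_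
    rintro _ ⟨n, rfl⟩
    exact ⟨(n.base⁻¹ * x.base * n.base, n.indet), ⟨hmem _, Set.mem_univ _⟩,
      (rightCoset_centralizer x n).symm⟩

theorem indet_pow_succ (x : NeutroGroup G) (n : ℕ) : (x ^ (n + 1)).indet = x.indet := by
  induction n with
  | zero => simp
  | succ n ih => rw [pow_succ, mul_def, ih, Bool.or_self]

/-- The elements `g I` have infinite order, encoded as `orderOf = 0`, so only elements of `G` matter
for the condition on `Δ`. -/
theorem forall_mem_Delta_orderOf_ne_iff {p : ℕ} (hp : 0 < p) :
    (∀ x ∈ Delta G, orderOf x ≠ p) ↔ ∀ g ∈ fcCenter G, orderOf g ≠ p := by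
  constructor
  · intro h g hg
    rw [← orderOf_injective of of_injective]
    exact h _ (mem_Delta_iff.2 hg)
  · rintro h ⟨g, b⟩ hx hord
    have hb : b = false := by
      have h1 := pow_orderOf_eq_one (⟨g, b⟩ : NeutroGroup G)
      rw [hord, ← Nat.succ_pred_eq_of_pos hp] at h1
      exact (indet_pow_succ ⟨g, b⟩ p.pred).symm.trans (congrArg indet h1)
    subst hb
    refine h g (mem_Delta_iff.1 hx) ?_
    rw [← orderOf_injective of of_injective]
    exact hord

theorem IsSubgroup.indet_eq_false {P : Submonoid (NeutroGroup G)} (hP : IsSubgroup P)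
    {x : NeutroGroup G} (hx : x ∈ P) : x.indet = false := by
  obtain ⟨y, -, hxy, -⟩ := hP x hx
  have := congrArg indet hxy
  simp only [mul_def, one_def, Bool.or_eq_false_iff] at this
  exact this.1

/-- The subgroup of `G` underlying a subgroup of `⟨G ∪ I⟩`. -/
def IsSubgroup.toSubgroup {P : Submonoid (NeutroGroup G)} (hP : IsSubgroup P) : Subgroup G where
  toSubmonoid := P.comap of
  inv_mem' {g} hg := by
    obtain ⟨y, hy, hxy, -⟩ := hP _ hg
    have hy' := hP.indet_eq_false hy
    have h1 : g * y.base = 1 := congrArg base hxy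
    have : of g⁻¹ = y := NeutroGroup.ext (inv_eq_of_mul_eq_one_right h1) hy'.symm
    change of g⁻¹ ∈ P
    rwa [this]

theorem IsSubgroup.mem_toSubgroup {P : Submonoid (NeutroGroup G)} (hP : IsSubgroup P) {g : G} :
    g ∈ hP.toSubgroup ↔ of g ∈ P := Iff.rfl

theorem IsSubgroup.mem_iff {P : Submonoid (NeutroGroup G)} (hP : IsSubgroup P)
    {x : NeutroGroup G} : x ∈ P ↔ x.indet = false ∧ x.base ∈ hP.toSubgroup := by
  constructor
  · intro hx
    have hi := hP.indet_eq_false hx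
    refine ⟨hi, hP.mem_toSubgroup.2 ?_⟩
    have : of x.base = x := NeutroGroup.ext rfl hi.symm
    rwa [this]
  · rintro ⟨hi, hx⟩
    have : of x.base = x := NeutroGroup.ext rfl hi.symm
    rw [← this]
    exact hx

theorem IsNormal.of_conj_mem {P : Submonoid (NeutroGroup G)} (hP : IsNormal P) {g : G}
    (hg : of g ∈ P) (x : G) : of (x * g * x⁻¹) ∈ P := by
  obtain ⟨h, hh, he⟩ := (hP (of x)).subset ⟨of g, hg, rfl⟩
  have h1 : h.base * x = x * g := congrArg base he
  have h2 : h.indet = false := by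
    have := congrArg indet he
    simpa [mul_def, of] using this
  have : of (x * g * x⁻¹) = h := NeutroGroup.ext (by rw [← h1]; simp [of]) h2.symm
  rwa [this]

theorem IsSubgroup.card_toSubgroup {P : Submonoid (NeutroGroup G)} (hP : IsSubgroup P) :
    Nat.card hP.toSubgroup = Nat.card P := by
  refine Nat.card_congr
    { toFun := fun g => ⟨of g, g.2⟩
      invFun := fun x => ⟨x.1.base, (hP.mem_iff.1 x.2).2⟩
      left_inv := fun _ => rfl
      right_inv := fun x => Subtype.ext (NeutroGroup.ext rfl (hP.indet_eq_false x.2).symm) }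

theorem IsSubgroup.mem_closure_union_I_iff {H : Submonoid (NeutroGroup G)} (hH : IsSubgroup H)
    {x : NeutroGroup G} :
    x ∈ Submonoid.closure ((H : Set (NeutroGroup G)) ∪ {I G}) ↔ x.base ∈ hH.toSubgroup := by
  constructor
  · intro hx
    have hle : Submonoid.closure ((H : Set (NeutroGroup G)) ∪ {I G}) ≤
        hH.toSubgroup.toSubmonoid.comap baseHom := by
      rw [Submonoid.closure_le]
      rintro y (hy | rfl)
      · exact (hH.mem_iff.1 hy).2
      · exact one_mem hH.toSubgroup
    exact hle hx
  · intro hx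
    have h1 : of x.base ∈ Submonoid.closure ((H : Set (NeutroGroup G)) ∪ {I G}) :=
      Submonoid.subset_closure (Or.inl hx)
    obtain ⟨g, b⟩ := x
    cases b with
    | false => exact h1
    | true =>
      have h2 := mul_mem h1 (Submonoid.subset_closure
        (s := (H : Set (NeutroGroup G)) ∪ {I G}) (Or.inr rfl))
      simpa [of, I, mul_def] using h2

theorem IsSubgroup.card_closure_union_I {H : Submonoid (NeutroGroup G)} (hH : IsSubgroup H) :
    Nat.card (Submonoid.closure ((H : Set (NeutroGroup G)) ∪ {I G})) =
      2 * Nat.card hH.toSubgroup := by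
  have e : Submonoid.closure ((H : Set (NeutroGroup G)) ∪ {I G}) ≃ Bool × hH.toSubgroup :=
    { toFun := fun x => (x.1.indet, ⟨x.1.base, hH.mem_closure_union_I_iff.1 x.2⟩)
      invFun := fun q => ⟨⟨q.2, q.1⟩, hH.mem_closure_union_I_iff.2 q.2.2⟩
      left_inv := fun _ => rfl
      right_inv := fun _ => rfl }
  rw [Nat.card_congr e, Nat.card_prod, Nat.card_eq_fintype_card, Fintype.card_bool]

/-- The finite normal subgroups of `⟨G ∪ I⟩` are those of `G`, and the finite normal neutrosophic
subgroups are the `⟨H ∪ I⟩` with `H` finite normal in `G`, of order `2 |H|`. -/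
theorem forall_isNormal_not_dvd_card_iff {p : ℕ} (hp : p.Prime) :
    ((∀ P : Submonoid (NeutroGroup G), IsSubgroup P → IsNormal P → Finite P → ¬ p ∣ Nat.card P) ∧
      (p ≠ 2 → ∀ P : Submonoid (NeutroGroup G), IsNeutroSubgroup P → IsNormal P → Finite P →
        ¬ p ∣ Nat.card P)) ↔
    ∀ H : Subgroup G, H.Normal → Finite H → ¬ p ∣ Nat.card H := by
  constructor
  · rintro ⟨h, -⟩ H hn hfin hdvd
    have hsub : IsSubgroup (H.toSubmonoid.map of) := by
      rintro _ ⟨g, hg, rfl⟩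
      refine ⟨of g⁻¹, ⟨g⁻¹, H.inv_mem hg, rfl⟩, ?_, ?_⟩ <;> rw [← map_mul] <;> simp
    have heq : hsub.toSubgroup = H := by
      ext g
      rw [hsub.mem_toSubgroup]
      exact ⟨fun ⟨k, hk, hkg⟩ => of_injective hkg ▸ hk, fun hg => ⟨g, hg, rfl⟩⟩
    have hcard : Nat.card (H.toSubmonoid.map of) = Nat.card H := by
      rw [← hsub.card_toSubgroup, heq]
    refine h _ hsub ?_ ((Set.Finite.image of (Set.toFinite (H : Set G))).to_subtype) (hcard ▸ hdvd)
    intro x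
    ext y
    constructor
    · rintro ⟨_, ⟨g, hg, rfl⟩, rfl⟩
      exact ⟨of (x.base * g * x.base⁻¹), ⟨_, hn.conj_mem g hg x.base, rfl⟩, by simp [of, mul_def]⟩
    · rintro ⟨_, ⟨g, hg, rfl⟩, rfl⟩
      exact ⟨of (x.base⁻¹ * g * x.base), ⟨_, hn.conj_mem' g hg x.base, rfl⟩,
        by simp [of, mul_def, mul_assoc]⟩
  · intro h
    refine ⟨fun P hP hn hfin hdvd => ?_, ?_⟩
    · refine h hP.toSubgroup ⟨fun g hg x => hn.of_conj_mem hg x⟩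
        (Finite.of_injective (fun g => (⟨of g, g.2⟩ : P)) fun a b hab =>
          Subtype.ext (of_injective (congrArg Subtype.val hab))) ?_
      rwa [hP.card_toSubgroup]
    · rintro hp2 _ ⟨H, hH, rfl⟩ hn hfin hdvd
      have hmem : ∀ g, of g ∈ Submonoid.closure ((H : Set (NeutroGroup G)) ∪ {I G}) ↔
          g ∈ hH.toSubgroup := fun g => hH.mem_closure_union_I_iff
      refine h hH.toSubgroup
        ⟨fun g hg x => (hmem _).1 (hn.of_conj_mem ((hmem g).2 hg) x)⟩
        (Finite.of_injective
          (fun g => (⟨of g, (hmem g).2 g.2⟩ :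
            Submonoid.closure ((H : Set (NeutroGroup G)) ∪ {I G}))) fun a b hab =>
          Subtype.ext (of_injective (congrArg Subtype.val hab))) ?_
      rw [hH.card_closure_union_I] at hdvd
      exact (hp.dvd_mul.1 hdvd).resolve_left fun h2 =>
        hp2 ((Nat.prime_dvd_prime_iff_eq hp Nat.prime_two).1 h2)

end NeutroGroup

/-! ### The neutrosophic group ring -/

namespace NeutroGroup

open MonoidAlgebra

variable {K G : Type*} [Field K] [Group G]

/-- The multiplicative map from `⟨G ∪ I⟩` to `K[G]` that sends `I` to `0`. -/
noncomputable def killIHom (K G : Type*) [Field K] [Group G] :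
    NeutroGroup G →* MonoidAlgebra K G where
  toFun x := if x.indet then 0 else single x.base 1
  map_one' := by simp [one_def, MonoidAlgebra.one_def]
  map_mul' x y := by
    cases hx : x.indet <;> cases hy : y.indet <;> simp [mul_def, hx, hy, single_mul_single]

/-- The algebra map `K[⟨G ∪ I⟩] → K[G]` that is the identity on `G` and has `I ↦ 1`. -/
noncomputable def evalOne (K G : Type*) [Field K] [Group G] :
    MonoidAlgebra K (NeutroGroup G) →ₐ[K] MonoidAlgebra K G :=
  MonoidAlgebra.lift K _ _ ((MonoidAlgebra.of K G).comp baseHom)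

/-- The algebra map `K[⟨G ∪ I⟩] → K[G]` that is the identity on `G` and has `I ↦ 0`. -/
noncomputable def evalZero (K G : Type*) [Field K] [Group G] :
    MonoidAlgebra K (NeutroGroup G) →ₐ[K] MonoidAlgebra K G :=
  MonoidAlgebra.lift K _ _ (killIHom K G)

theorem coeff_evalOne (α : MonoidAlgebra K (NeutroGroup G)) (g : G) :
    (evalOne K G α).coeff g = α.coeff ⟨g, false⟩ + α.coeff ⟨g, true⟩ := by
  classical
  induction α using MonoidAlgebra.induction_linear with
  | zero => simp
  | add a b ha hb => rw [map_add]; simp only [coeff_add, Finsupp.add_apply, ha, hb]; ring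
  | single x a =>
    obtain ⟨k, b⟩ := x
    cases b <;> simp [evalOne, baseHom, Finsupp.single_apply]

theorem coeff_evalZero (α : MonoidAlgebra K (NeutroGroup G)) (g : G) :
    (evalZero K G α).coeff g = α.coeff ⟨g, false⟩ := by
  classical
  induction α using MonoidAlgebra.induction_linear with
  | zero => simp
  | add a b ha hb => rw [map_add]; simp only [coeff_add, Finsupp.add_apply, ha, hb]
  | single x a =>
    obtain ⟨k, b⟩ := x
    cases b <;> simp [evalZero, killIHom, Finsupp.single_apply]

theorem surjective_evalOne : Function.Surjective (evalOne K G) := by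
  intro x
  induction x using MonoidAlgebra.induction_linear with
  | zero => exact ⟨0, map_zero _⟩
  | add a b ha hb =>
    obtain ⟨a', rfl⟩ := ha
    obtain ⟨b', rfl⟩ := hb
    exact ⟨a' + b', map_add _ _ _⟩
  | single g a => exact ⟨single (of g) a, by simp [evalOne, baseHom, of]⟩

theorem surjective_evalZero : Function.Surjective (evalZero K G) := by
  intro x
  induction x using MonoidAlgebra.induction_linear with
  | zero => exact ⟨0, map_zero _⟩
  | add a b ha hb =>
    obtain ⟨a', rfl⟩ := ha
    obtain ⟨b', rfl⟩ := hb
    exact ⟨a' + b', map_add _ _ _⟩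
  | single g a => exact ⟨single (of g) a, by simp [evalZero, killIHom, of]⟩

/-- The maps `I ↦ 1` and `I ↦ 0` embed `K[⟨G ∪ I⟩]` in `K[G] × K[G]`, so Passman's theorem for
`K[G]` applies to both images of an ideal of square zero. -/
theorem isSemiprimeRing_of_forall_orderOf_ne (p : ℕ) [Fact p.Prime] [CharP K p]
    (hp : ∀ x ∈ fcCenter G, orderOf x ≠ p) :
    IsSemiprimeRing (MonoidAlgebra K (NeutroGroup G)) := by
  intro J hJ
  rw [eq_bot_iff]
  intro α hα
  have hzero : ∀ f : MonoidAlgebra K (NeutroGroup G) →ₐ[K] MonoidAlgebra K G,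
      Function.Surjective f → f α = 0 := by
    intro f hf
    refine eq_zero_of_forall_mul_mul_eq_zero p hp _ fun x => ?_
    obtain ⟨y, rfl⟩ := hf x
    rw [← map_mul, ← map_mul, hJ _ (J.mul_mem_right _ _ hα) _ hα, map_zero]
  have h0 : ∀ g, α.coeff ⟨g, false⟩ = 0 := by
    intro g
    rw [← coeff_evalZero, hzero _ surjective_evalZero]
    rfl
  have h1 : ∀ g, α.coeff ⟨g, true⟩ = 0 := by
    intro g
    have := coeff_evalOne α g
    rw [hzero _ surjective_evalOne, h0, zero_add] at this
    exact this.symm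
  rw [TwoSidedIdeal.mem_bot]
  ext ⟨g, b⟩
  cases b
  · exact h0 g
  · exact h1 g

/-- The sum of the elements of a finite normal subgroup of order divisible by the characteristic
is a central element of square zero, so it generates an ideal of square zero. -/
theorem not_dvd_card_of_isSemiprimeRing (p : ℕ) [CharP K p]
    (hsp : IsSemiprimeRing (MonoidAlgebra K (NeutroGroup G))) (H : Subgroup G) (hn : H.Normal)
    (hfin : Finite H) : ¬ p ∣ Nat.card H := by
  classical
  intro hdvd
  have := Fintype.ofFinite H
  set e : MonoidAlgebra K (NeutroGroup G) := ∑ h : H, single (of (h : G)) 1 with he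
  have hcentral_single : ∀ (x : NeutroGroup G) (a : K), e * single x a = single x a * e := by
    intro x a
    rw [he, Finset.sum_mul, Finset.mul_sum,
      ← (MulAut.conjNormal x.base : MulAut H).toEquiv.sum_comp]
    refine Finset.sum_congr rfl fun h _ => ?_
    rw [single_mul_single, single_mul_single, one_mul, mul_one]
    congr 1
    simp [of, mul_def, MulAut.conjNormal_apply]
  have hcentral : ∀ y, e * y = y * e := by
    intro y
    induction y using MonoidAlgebra.induction_linear with
    | zero => simp
    | add a b ha hb => rw [mul_add, add_mul, ha, hb]
    | single x a => exact hcentral_single x a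
  have hsq : e * e = 0 := by
    have habs : ∀ h : H, single (of (h : G)) 1 * e = e := by
      intro h
      rw [he, Finset.mul_sum]
      refine Fintype.sum_equiv (Equiv.mulLeft h) _ _ fun k => ?_
      rw [single_mul_single, one_mul, ← map_mul]
      rfl
    have hcard : ((Nat.card H : ℕ) : K) = 0 := (CharP.cast_eq_zero_iff K p _).2 hdvd
    calc e * e = ∑ h : H, single (of (h : G)) 1 * e := by rw [← Finset.sum_mul]
      _ = Fintype.card H • e := by simp [habs]
      _ = ((Nat.card H : ℕ) : K) • e := by rw [Nat.cast_smul_eq_nsmul, Nat.card_eq_fintype_card]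
      _ = 0 := by rw [hcard, zero_smul]
  let J : TwoSidedIdeal (MonoidAlgebra K (NeutroGroup G)) :=
    TwoSidedIdeal.mk' {z | ∃ y, e * y = z} ⟨0, mul_zero e⟩
      (by rintro _ _ ⟨a, rfl⟩ ⟨b, rfl⟩; exact ⟨a + b, mul_add e a b⟩)
      (by rintro _ ⟨a, rfl⟩; exact ⟨-a, mul_neg e a⟩)
      (by rintro x _ ⟨a, rfl⟩; exact ⟨x * a, by rw [← mul_assoc, ← mul_assoc, hcentral]⟩)
      (by rintro _ y ⟨a, rfl⟩; exact ⟨a * y, (mul_assoc e a y).symm⟩)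
  have hmem : ∀ z, z ∈ J ↔ ∃ y, e * y = z := fun z => TwoSidedIdeal.mem_mk' ..
  have hJ : J = ⊥ := by
    refine hsp J fun a ha b hb => ?_
    obtain ⟨x, rfl⟩ := (hmem a).1 ha
    obtain ⟨y, rfl⟩ := (hmem b).1 hb
    rw [hcentral x, mul_assoc, ← mul_assoc e e, hsq, zero_mul, mul_zero]
  have he0 : e = 0 := by
    rw [← TwoSidedIdeal.mem_bot, ← hJ]
    exact (hmem e).2 ⟨1, mul_one e⟩
  have hcoeff : e.coeff (of 1) = 1 := by
    rw [he, coeff_sum, Finset.sum_apply', Finset.sum_eq_single (1 : H)]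
    · exact Finsupp.single_eq_same
    · intro h _ hne
      exact Finsupp.single_eq_of_ne fun h' => hne (Subtype.ext (of_injective h'.symm))
    · simp
  rw [he0] at hcoeff
  exact zero_ne_one hcoeff

end NeutroGroup

/-! ### The equivalence -/

theorem theorem3p2p4 {K : Type*} [Field K] (p : ℕ) [CharP K p] (hp : 0 < p)
    (G : Type*) [Group G] :
    List.TFAE [
      IsSemiprimeRing (MonoidAlgebra K (NeutroGroup G)),
      ∀ x ∈ NeutroGroup.Delta G, orderOf x ≠ p,
      (∀ P : Submonoid (NeutroGroup G), NeutroGroup.IsSubgroup P → NeutroGroup.IsNormal P →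
          Finite P → ¬ p ∣ Nat.card P) ∧
        (p ≠ 2 → ∀ P : Submonoid (NeutroGroup G), NeutroGroup.IsNeutroSubgroup P →
          NeutroGroup.IsNormal P → Finite P → ¬ p ∣ Nat.card P)] := by
  have hprime : p.Prime := (CharP.char_is_prime_or_zero K p).resolve_right hp.ne'
  have := Fact.mk hprime
  rw [NeutroGroup.forall_mem_Delta_orderOf_ne_iff hp,
    NeutroGroup.forall_isNormal_not_dvd_card_iff hprime,
    forall_mem_fcCenter_orderOf_ne_iff hprime]
  tfae_have 1 → 2 := fun h H => NeutroGroup.not_dvd_card_of_isSemiprimeRing p h H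
  tfae_have 2 → 1 := fun h => NeutroGroup.isSemiprimeRing_of_forall_orderOf_ne p
    ((forall_mem_fcCenter_orderOf_ne_iff hprime).2 h)
  tfae_have 2 ↔ 3 := Iff.rfl
  tfae_finish
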